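/- Let $\wp$ be an odd prime and $m\ge 2$ an integer such that $3$ is a primitive root modulo $\wp^m$, i.e. the multiplicative order of $3$ modulo $\wp^m$ is $\phi(\wp^m)$. Let $q=3^{\phi(\wp^m)}$, let $\mathrm{Tr}:\mathbb{F}_q\to\mathbb{F}_3$ be the trace, and let $$D=\{x\in\mathbb{F}_q^*:\ \mathrm{Tr}(x^{(q-1)/\wp^m})=0\}=\{d_1,\dots,d_n\},\qquad n=\#D.$$ Consider the ternary linear code $$\mathcal{C}_D=\{(\mathrm{Tr}(d_1x),\dots,\mathrm{Tr}(d_nx)):\ x\in\mathbb{F}_q\}\subseteq\mathbb{F}_3^n$$ and its dual $\mathcal{C}_D^{\perp}=\{v\in\mathbb{F}_3^n:\ \sum_{i=1}^n c_iv_i=0\text{ for all }c\in\mathcal{C}_D\}$, and put $k=\dim_{\mathbb{F}_3}\mathcal{C}_D^{\perp}$. An $[n,k,d]$ ternary code is a $k$-dimensional subspace of $\mathbb{F}_3^n$ with minimum Hamming distance $d$, and such a code is called optimal if no $[n,k,d+1]$ ternary code exists. Then $\mathcal{C}_D^{\perp}$ has minimum distance $2$ and is optimal; that is, no ternary $[n,k,3]$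 code exists. -/

import Mathlib

open scoped Nat

section Codes

variable {K : Type*} [Field K] [DecidableEq K] {n : ℕ}

/-- `d` is the minimum Hamming distance of the linear code `C` of length `n` over `K`: the least
distance between two distinct codewords. It does not exist for the zero code. -/
def IsMinDistance (C : Submodule K (Fin n → K)) (d : ℕ) : Prop :=
  IsLeast {w : ℕ | ∃ x ∈ C, ∃ y ∈ C, x ≠ y ∧ hammingDist x y = w} d

/-- `C` is an `[n, k, d]` linear code over `K`: a `k`-dimensional subspace of `K ^ n` with minimum
distance `d`. -/
structure IsLinearCode (C : Submodule K (Fin n → K)) (k d : ℕ) : Prop where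
  dim : Module.finrank K C = k
  minDistance : IsMinDistance C d

/-- A code with parameters `[n, k, d]` is optimal if there is no `[n, k, d + 1]` code over the same
field. -/
def IsOptimalCode (C : Submodule K (Fin n → K)) : Prop :=
  ∃ k d : ℕ, IsLinearCode C k d ∧ ¬ ∃ C' : Submodule K (Fin n → K), IsLinearCode C' k (d + 1)

end Codes

section TraceCodes

/-- The dual code: all vectors orthogonal to every codeword for the standard bilinear form. -/
def dualCode {K : Type*} [Field K] {n : ℕ} (C : Submodule K (Fin n → K)) :
    Submodule K (Fin n → K) where
  carrier := {v | ∀ c ∈ C, ∑ i, c i * v i = 0}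
  zero_mem' := by
    intro c _
    simp
  add_mem' := by
    intro v w hv hw c hc
    simp [mul_add, Finset.sum_add_distrib, hv c hc, hw c hc]
  smul_mem' := by
    intro a v hv c hc
    have h : ∑ i, c i * (a • v) i = a * ∑ i, c i * v i := by
      rw [Finset.mul_sum]
      refine Finset.sum_congr rfl fun i _ => ?_
      simp only [Pi.smul_apply, smul_eq_mul]
      ring
    rw [h, hv c hc, mul_zero]

/-- The code `{(Tr(d₁x), …, Tr(dₙx)) : x ∈ F}` over `K` defined by the family `d₁, …, dₙ` of
elements of the extension field `F` of `K`. -/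
noncomputable def traceCode (K : Type*) {F : Type*} [Field K] [Field F] [Algebra K F] {n : ℕ}
    (d : Fin n → F) : Submodule K (Fin n → K) :=
  LinearMap.range (LinearMap.pi fun i => Algebra.trace K F ∘ₗ LinearMap.mulLeft K (d i))

/-- The defining set `{x ∈ F : x ≠ 0, Tr(x ^ ((q - 1) / N)) = 0}`, where `q` is the order of the
finite extension field `F` of `K`; it is used when `N` divides `q - 1`. -/
def traceZeroSet (K F : Type*) [Field K] [Field F] [Algebra K F] (N : ℕ) : Set F :=
  {x : F | x ≠ 0 ∧ Algebra.trace K F (x ^ ((Nat.card F - 1) / N)) = 0}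

end TraceCodes

/-! ### Vectors of small weight and sphere packing. -/

section HammingMetric

variable {K : Type*} [Field K] [DecidableEq K] {n : ℕ}

/-! Let `N = ℓ ^ m`, `q = |F|`, and `ζ = x ^ ((q - 1) / N)` for `x ≠ 0`. Since 3 generates the units
mod `N`, the trace of `ζ` is the sum of `ζ ^ a` over units `a`. The shift `a ↦ a + ℓ` permutes the
units and multiplies the sum by `ζ ^ ℓ`, so the trace vanishes unless `ζ ^ ℓ = 1`
(`sum_pow_pow_eq_zero`). At most a third of the nonzero `x` are exceptional, hence `2 * n + 1 > q`.

The dual code is the space of linear relations among the `d i`, so its codimension is at most `[F :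
K]`. Minimum distance 3 would force `2 * n + 1 ≤ q` by sphere packing, while `D = -D` gives words of
weight 2. -/

lemma hammingDist_eq_hammingDist_sub_zero (x y : Fin n → K) :
    hammingDist x y = hammingDist (x - y) 0 := by
  rw [hammingDist_zero_right, hammingDist_comm, hammingDist_eq_hammingNorm, neg_add_eq_sub]

lemma hammingDist_single_zero_le_one (i : Fin n) (a : K) :
    hammingDist (Pi.single i a : Fin n → K) 0 ≤ 1 := by
  rw [hammingDist]
  refine Finset.card_le_one.2 fun j hj k hk => ?_
  have key : ∀ l : Fin n, l ∈ Finset.univ.filter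
      (fun l => (Pi.single i a : Fin n → K) l ≠ (0 : Fin n → K) l) → l = i := by
    intro l hl
    by_contra h
    simp [Pi.single_apply, h] at hl
  rw [key j hj, key k hk]

lemma exists_eq_single_of_hammingDist_zero_lt_two {v : Fin n → K} (hv : v ≠ 0)
    (h : hammingDist v 0 < 2) : ∃ i, v i ≠ 0 ∧ v = Pi.single i (v i) := by
  obtain ⟨i, hi⟩ := Function.ne_iff.1 hv
  refine ⟨i, hi, funext fun j => ?_⟩
  by_cases hj : j = i
  · subst hj; simp
  rw [Pi.single_eq_of_ne hj]
  by_contra hvj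
  have : 1 < hammingDist v 0 :=
    Finset.one_lt_card.2 ⟨i, by simpa using hi, j, by simpa using hvj, Ne.symm hj⟩
  omega

/-- The sphere packing bound for linear codes that correct one error. -/
lemma sphere_packing_of_three_le_hammingDist [Finite K] (C : Submodule K (Fin n → K))
    (hC : ∀ x ∈ C, x ≠ 0 → 3 ≤ hammingDist x 0) :
    n * (Nat.card K - 1) + 1 ≤ Nat.card K ^ (n - Module.finrank K C) := by
  -- `e` enumerates the ball of radius 1 around 0; `none` is the centre.
  let e : Option (Fin n × Kˣ) → Fin n → K := fun o => o.elim 0 fun p => Pi.single p.1 (p.2 : K)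
  have he : ∀ o, hammingDist (e o) 0 ≤ 1 := by
    rintro (_ | p)
    · simp [e]
    · exact hammingDist_single_zero_le_one p.1 (p.2 : K)
  have e_inj : Function.Injective e := by
    rintro (_ | ⟨i, a⟩) (_ | ⟨j, b⟩) h
    · rfl
    · have := congrFun h j
      exact absurd this.symm (by simp [e])
    · have := congrFun h i
      simp [e] at this
    · have hij : i = j := by
        by_contra hij
        have := congrFun h i
        simp [e, hij] at this
      subst hij
      have := congrFun h i
      simp only [e, Option.elim_some, Pi.single_eq_same] at this
      rw [Units.ext this]
  -- Two points of the ball differ by weight at most 2, so they lie in distinct cosets of `C`.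
  have inj : Function.Injective fun o => C.mkQ (e o) := by
    intro o p h
    have hmem : e o - e p ∈ C := (Submodule.Quotient.eq C).1 h
    by_contra hop
    have h3 := hC _ hmem (sub_ne_zero.2 fun h => hop (e_inj h))
    have h2 := hammingDist_triangle (e o) 0 (e p)
    rw [hammingDist_comm 0 (e p)] at h2
    rw [hammingDist_eq_hammingDist_sub_zero] at h2
    have := he o
    have := he p
    omega
  have : Finite ((Fin n → K) ⧸ C) := Finite.of_surjective _ C.mkQ_surjective
  have hcard := Nat.card_le_card_of_injective _ inj
  rw [Module.natCard_eq_pow_finrank (K := K) (V := (Fin n → K) ⧸ C), Submodule.finrank_quotient,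
    Module.finrank_fin_fun, Finite.card_option, Nat.card_prod, Nat.card_fin, Nat.card_units] at hcard
  exact hcard

end HammingMetric

/-! ### Duals of trace codes as spaces of linear relations. -/

section TraceDual

variable {K F : Type*} [Field K] [Field F] [Algebra K F] {n : ℕ}

/-- Orthogonality to the code says that `∑ i, v i • d i` pairs to zero with all of `F` under the
trace form, which is nondegenerate. -/
lemma mem_dualCode_traceCode_iff [FiniteDimensional K F] [Algebra.IsSeparable K F]
    (d : Fin n → F) (v : Fin n → K) :
    v ∈ dualCode (traceCode K d) ↔ ∑ i, v i • d i = 0 := by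
  have hsum : ∀ x : F, ∑ i, Algebra.trace K F (d i * x) * v i =
      Algebra.traceForm K F (∑ i, v i • d i) x := by
    intro x
    rw [Algebra.traceForm_apply, Finset.sum_mul, map_sum]
    refine Finset.sum_congr rfl fun i _ => ?_
    rw [smul_mul_assoc, map_smul, smul_eq_mul, mul_comm]
  constructor
  · intro hv
    refine (traceForm_nondegenerate K F).1 _ fun x => ?_
    rw [← hsum]
    exact hv _ ⟨x, rfl⟩
  · rintro hv _ ⟨x, rfl⟩
    change ∑ i, Algebra.trace K F (d i * x) * v i = 0
    rw [hsum, hv]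
    simp

lemma le_finrank_dualCode_traceCode [FiniteDimensional K F] [Algebra.IsSeparable K F]
    (d : Fin n → F) :
    n ≤ Module.finrank K (dualCode (traceCode K d)) + Module.finrank K F := by
  have hker : dualCode (traceCode K d) = LinearMap.ker (Fintype.linearCombination K d) := by
    ext v
    rw [mem_dualCode_traceCode_iff, LinearMap.mem_ker, Fintype.linearCombination_apply]
  have h := (Fintype.linearCombination K d).finrank_range_add_finrank_ker
  have := Submodule.finrank_le (LinearMap.range (Fintype.linearCombination K d))
  rw [Module.finrank_fin_fun] at h
  rw [hker]
  omega

/-- The dual of a trace code given by nonzero elements, two of which are opposite, has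
minimum distance two. -/
lemma isMinDistance_dualCode_traceCode_two [DecidableEq K] [FiniteDimensional K F]
    [Algebra.IsSeparable K F] (d : Fin n → F) (hd : ∀ i, d i ≠ 0) {i j : Fin n} (hij : i ≠ j)
    (hneg : d j = -d i) : IsMinDistance (dualCode (traceCode K d)) 2 := by
  constructor
  · refine ⟨Pi.single i 1 + Pi.single j 1, ?_, 0, Submodule.zero_mem _, ?_, ?_⟩
    · rw [mem_dualCode_traceCode_iff]
      simp [add_smul, Finset.sum_add_distrib, Pi.single_apply, ite_smul, hneg]
    · intro h
      have := congrFun h i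
      simp [hij] at this
    · have : (Finset.univ.filter fun l =>
          (Pi.single i 1 + Pi.single j 1 : Fin n → K) l ≠ (0 : Fin n → K) l) = {i, j} := by
        ext l
        by_cases hi : l = i
        · subst hi; simp [hij]
        · by_cases hj : l = j
          · subst hj; simp [hi]
          · simp [hi, hj]
      rw [hammingDist, this, Finset.card_pair hij]
  · rintro w ⟨x, hx, y, hy, hxy, rfl⟩
    by_contra! h
    rw [hammingDist_eq_hammingDist_sub_zero] at h
    obtain ⟨l, hl, hsingle⟩ :=
      exists_eq_single_of_hammingDist_zero_lt_two (sub_ne_zero.2 hxy) h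
    have hmem := (mem_dualCode_traceCode_iff d _).1 (Submodule.sub_mem _ hx hy)
    rw [hsingle] at hmem
    simp only [Pi.single_apply, ite_smul, zero_smul, Finset.sum_ite_eq', Finset.mem_univ,
      if_true, smul_eq_zero] at hmem
    exact hmem.elim hl (hd l)

/-- The dual of a trace code of length `n` with `n (|K| - 1) + 1 > |F|` has dimension too large
for minimum distance three. -/
lemma isOptimalCode_dualCode_traceCode [DecidableEq K] [Finite K] [Finite F]
    (d : Fin n → F) (h2 : IsMinDistance (dualCode (traceCode K d)) 2)
    (hn : Nat.card F < n * (Nat.card K - 1) + 1) :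
    IsOptimalCode (dualCode (traceCode K d)) := by
  refine ⟨_, 2, ⟨rfl, h2⟩, ?_⟩
  rintro ⟨C, hdim, hmin⟩
  have hpack := sphere_packing_of_three_le_hammingDist C fun x hx h0 =>
    hmin.2 ⟨x, hx, 0, Submodule.zero_mem _, h0, rfl⟩
  rw [Module.natCard_eq_pow_finrank (K := K) (V := F)] at hn
  have hle := le_finrank_dualCode_traceCode (K := K) d
  rw [← hdim] at hle
  have := Nat.pow_le_pow_right (Nat.card_pos (α := K))
    (show n - Module.finrank K C ≤ Module.finrank K F by omega)
  omega

end TraceDual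

/-! ### Sums of roots of unity over the units mod `ℓ ^ m`. -/

section RootsOfUnity

/-- If `g` has the largest possible order `φ N` modulo `N`, its powers are all the units. -/
lemma image_pow_eq_filter_isUnit {N : ℕ} [NeZero N] {g : ZMod N} (hg : orderOf g = φ N) :
    (Finset.range (φ N)).image (fun i => g ^ i) = Finset.univ.filter (fun a => IsUnit a) := by
  have hpos : 0 < φ N := Nat.totient_pos.2 (NeZero.pos N)
  have hunit : IsUnit g :=
    IsUnit.of_pow_eq_one (n := φ N) (hg ▸ pow_orderOf_eq_one g) hpos.ne'
  refine Finset.eq_of_subset_of_card_le ?_ ?_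
  · intro a ha
    obtain ⟨i, -, rfl⟩ := Finset.mem_image.1 ha
    simpa using hunit.pow i
  · rw [Finset.card_image_of_injOn, Finset.card_range]
    · have : (Finset.univ.filter fun a : ZMod N => IsUnit a) ⊆
          Finset.univ.image (fun u : (ZMod N)ˣ => (u : ZMod N)) := by
        intro a ha
        obtain ⟨u, rfl⟩ := (Finset.mem_filter.1 ha).2
        simp
      refine (Finset.card_le_card this).trans (Finset.card_image_le.trans ?_)
      rw [Finset.card_univ, ZMod.card_units_eq_totient]
    · intro i hi j hj h
      simp only [Finset.coe_range, Set.mem_Iio] at hi hj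
      exact pow_injOn_Iio_orderOf (hg ▸ hi) (hg ▸ hj) h

/-- The sum of `ζ ^ (g ^ i)` over one period of a primitive root `g` modulo `ℓ ^ m` vanishes for
every `ℓ ^ m`-th root of unity `ζ` whose order does not divide `ℓ`. -/
lemma sum_pow_pow_eq_zero {F : Type*} [Field F] {ℓ m g : ℕ} (hℓ : ℓ.Prime)
    (hg : orderOf (g : ZMod (ℓ ^ m)) = φ (ℓ ^ m)) {ζ : F} (hζ : ζ ^ ℓ ^ m = 1)
    (hζℓ : ζ ^ ℓ ≠ 1) : ∑ i ∈ Finset.range (φ (ℓ ^ m)), ζ ^ g ^ i = 0 := by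
  have : NeZero (ℓ ^ m) := ⟨pow_ne_zero _ hℓ.ne_zero⟩
  let f : ZMod (ℓ ^ m) → F := fun a => ζ ^ a.val
  have hf : ∀ k : ℕ, f k = ζ ^ k := fun k => by
    simp only [f, ZMod.val_natCast]
    exact (pow_eq_pow_mod k hζ).symm
  have hadd : ∀ a, f (a + (ℓ : ZMod (ℓ ^ m))) = f a * ζ ^ ℓ := fun a => by
    obtain ⟨k, rfl⟩ := ZMod.natCast_zmod_surjective a
    rw [← Nat.cast_add, hf, hf, pow_add]
  have hsum : ∑ i ∈ Finset.range (φ (ℓ ^ m)), ζ ^ g ^ i =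
      ∑ a ∈ Finset.univ.filter (fun a : ZMod (ℓ ^ m) => IsUnit a), f a := by
    rw [← image_pow_eq_filter_isUnit hg, Finset.sum_image]
    · refine Finset.sum_congr rfl fun i _ => ?_
      rw [← hf, Nat.cast_pow]
    · intro i hi j hj h
      simp only [Finset.coe_range, Set.mem_Iio] at hi hj
      exact pow_injOn_Iio_orderOf (by simpa [hg] using hi) (by simpa [hg] using hj) h
  -- Adding a nilpotent element preserves units.
  have hnil : IsNilpotent (ℓ : ZMod (ℓ ^ m)) :=
    ⟨m, by rw [← Nat.cast_pow, ZMod.natCast_self]⟩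
  have hshift : ∑ a ∈ Finset.univ.filter (fun a : ZMod (ℓ ^ m) => IsUnit a), f a =
      (∑ a ∈ Finset.univ.filter (fun a : ZMod (ℓ ^ m) => IsUnit a), f a) * ζ ^ ℓ := by
    rw [Finset.sum_mul]
    symm
    refine Finset.sum_bij (fun a _ => a + (ℓ : ZMod (ℓ ^ m))) ?_ ?_ ?_ ?_
    · intro a ha
      simp only [Finset.mem_filter, Finset.mem_univ, true_and] at ha ⊢
      exact hnil.isUnit_add_left_of_commute ha (Commute.all _ _)
    · intro a _ b _ h
      exact add_right_cancel h
    · intro b hb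
      simp only [Finset.mem_filter, Finset.mem_univ, true_and] at hb
      refine ⟨b - ℓ, ?_, sub_add_cancel _ _⟩
      simp only [Finset.mem_filter, Finset.mem_univ, true_and]
      rw [sub_eq_add_neg]
      exact hnil.neg.isUnit_add_left_of_commute hb (Commute.all _ _)
    · intro a _
      exact (hadd a).symm
  rw [hsum]
  by_contra h
  exact hζℓ (mul_left_cancel₀ h (by rw [mul_one, ← hshift]))

end RootsOfUnity

/-! ### Size and symmetry of the defining set. -/

section DefiningSet

variable {F : Type*} [Field F] [Algebra (ZMod 3) F] {ℓ m : ℕ}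

/-- The trace is the sum of the `φ (ℓ ^ m)` Frobenius conjugates `ζ ^ 3 ^ i`, a full period of the
primitive root 3. -/
lemma trace_eq_zero_of_pow_eq_one [Finite F] (hℓ : ℓ.Prime)
    (h_prim : orderOf (3 : ZMod (ℓ ^ m)) = φ (ℓ ^ m)) (hF : Nat.card F = 3 ^ φ (ℓ ^ m)) {ζ : F}
    (hζ : ζ ^ ℓ ^ m = 1) (hζℓ : ζ ^ ℓ ≠ 1) : Algebra.trace (ZMod 3) F ζ = 0 := by
  have hrank : Module.finrank (ZMod 3) F = φ (ℓ ^ m) := by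
    have h := Module.natCard_eq_pow_finrank (K := ZMod 3) (V := F)
    rw [hF, Nat.card_zmod] at h
    exact Nat.pow_right_injective (by norm_num : 2 ≤ 3) h.symm
  refine (algebraMap (ZMod 3) F).injective ?_
  rw [map_zero, FiniteField.algebraMap_trace_eq_sum_pow, hrank, Nat.card_zmod]
  exact sum_pow_pow_eq_zero hℓ (by exact_mod_cast h_prim) hζ hζℓ

lemma pow_dvd_card_sub_one (h_prim : orderOf (3 : ZMod (ℓ ^ m)) = φ (ℓ ^ m)) :
    ℓ ^ m ∣ 3 ^ φ (ℓ ^ m) - 1 := by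
  have h := pow_orderOf_eq_one (3 : ZMod (ℓ ^ m))
  rw [h_prim] at h
  rw [← CharP.cast_eq_zero_iff (ZMod (ℓ ^ m)), Nat.cast_sub (Nat.one_le_pow _ _ (by norm_num))]
  push_cast
  rw [h, sub_self]

/-- The defining set contains more than half of the nonzero elements. -/
lemma card_lt_two_mul_card_traceZeroSet [Finite F] (hℓ : ℓ.Prime) (hℓ_odd : Odd ℓ) (hm : 1 < m)
    (h_prim : orderOf (3 : ZMod (ℓ ^ m)) = φ (ℓ ^ m)) (hF : Nat.card F = 3 ^ φ (ℓ ^ m)) :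
    Nat.card F < 2 * Nat.card (traceZeroSet (ZMod 3) F (ℓ ^ m)) + 1 := by
  obtain ⟨M, hM⟩ := pow_dvd_card_sub_one h_prim
  rw [← hF] at hM
  have hcard : 1 < Nat.card F := Finite.one_lt_card
  have hNpos : 0 < ℓ ^ m := pow_pos hℓ.pos m
  have hMpos : 0 < M := by
    rcases Nat.eq_zero_or_pos M with rfl | h
    · omega
    · exact h
  have hℓ3 : 3 ≤ ℓ := by
    have := hℓ.two_le
    obtain ⟨k, rfl⟩ := hℓ_odd
    omega
  -- Every exceptional `x ≠ 0` satisfies `x ^ (M * ℓ) = 1`. Here `m ≥ 2` and `ℓ ≥ 3` enter, through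
  -- `3 * ℓ ≤ ℓ ^ m`.
  have hbound : 3 * (M * ℓ) ≤ Nat.card F - 1 := by
    rw [hM]
    have : 3 * ℓ ≤ ℓ ^ m :=
      calc 3 * ℓ ≤ ℓ ^ 2 := by nlinarith
        _ ≤ ℓ ^ m := Nat.pow_le_pow_right hℓ.pos hm
    nlinarith
  set D := traceZeroSet (ZMod 3) F (ℓ ^ m) with hD
  classical
  let R : Finset F := (Polynomial.nthRoots (M * ℓ) (1 : F)).toFinset
  have hR : R.card ≤ M * ℓ :=
    (Multiset.toFinset_card_le _).trans (Polynomial.card_nthRoots _ _)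
  have hcover : (Set.univ : Set F) ⊆ D ∪ (R ∪ {0}) := by
    intro x _
    by_cases hx : x = 0
    · right; right; exact hx
    by_cases hroot : x ^ (M * ℓ) = 1
    · right; left
      simpa [R, Polynomial.mem_nthRoots (Nat.mul_pos hMpos hℓ.pos)] using hroot
    · left
      refine ⟨hx, ?_⟩
      rw [hM, Nat.mul_div_cancel_left _ hNpos]
      refine trace_eq_zero_of_pow_eq_one hℓ h_prim hF ?_ ?_
      · rw [← pow_mul, mul_comm, ← hM]
        have := Fintype.ofFinite F
        rw [Nat.card_eq_fintype_card]
        exact FiniteField.pow_card_sub_one_eq_one x hx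
      · rwa [← pow_mul]
  have h := (Set.ncard_le_ncard hcover (Set.toFinite _)).trans (Set.ncard_union_le _ _)
  have h' := Set.ncard_union_le (R : Set F) {0}
  rw [Set.ncard_coe_finset, Set.ncard_singleton] at h'
  rw [Set.ncard_univ] at h
  rw [Nat.card_coe_set_eq]
  omega

/-- The exponent `(q - 1) / ℓ ^ m` is even, as `q - 1` is even and `ℓ ^ m` odd, so `x` and `-x` have
the same power. -/
lemma neg_mem_traceZeroSet (hℓ_odd : Odd ℓ)
    (h_prim : orderOf (3 : ZMod (ℓ ^ m)) = φ (ℓ ^ m)) (hF : Nat.card F = 3 ^ φ (ℓ ^ m)) {x : F}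
    (hx : x ∈ traceZeroSet (ZMod 3) F (ℓ ^ m)) : -x ∈ traceZeroSet (ZMod 3) F (ℓ ^ m) := by
  obtain ⟨M, hM⟩ := pow_dvd_card_sub_one h_prim
  have heven : Even (ℓ ^ m * M) :=
    hM ▸ Nat.Odd.sub_odd (Odd.pow (by decide)) odd_one
  have hMeven : Even M :=
    (Nat.even_mul.1 heven).resolve_left (Nat.not_even_iff_odd.2 hℓ_odd.pow)
  refine ⟨neg_ne_zero.2 hx.1, ?_⟩
  have hNpos : 0 < ℓ ^ m := pow_pos hℓ_odd.pos m
  have hexp : (Nat.card F - 1) / ℓ ^ m = M := by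
    rw [hF, hM, Nat.mul_div_cancel_left _ hNpos]
  have := hx.2
  rw [hexp] at this ⊢
  rwa [hMeven.neg_pow]

end DefiningSet

theorem corollary5p3 (ℓ m : ℕ) (hℓ : ℓ.Prime) (hℓ_odd : Odd ℓ) (hm : 1 < m)
    (h_prim : orderOf (3 : ZMod (ℓ ^ m)) = φ (ℓ ^ m))
    (F : Type*) [Field F] [Finite F] [Algebra (ZMod 3) F]
    (hF : Nat.card F = 3 ^ φ (ℓ ^ m))
    (n : ℕ) (d : Fin n ≃ traceZeroSet (ZMod 3) F (ℓ ^ m)) :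
    IsMinDistance (dualCode (traceCode (ZMod 3) fun i => (d i : F))) 2 ∧
      IsOptimalCode (dualCode (traceCode (ZMod 3) fun i => (d i : F))) := by
  have hcard := card_lt_two_mul_card_traceZeroSet hℓ hℓ_odd hm h_prim hF
  rw [← Nat.card_congr d, Nat.card_fin] at hcard
  have hone : 1 < Nat.card F := Finite.one_lt_card
  let i : Fin n := ⟨0, by omega⟩
  let j : Fin n := d.symm ⟨_, neg_mem_traceZeroSet hℓ_odd h_prim hF (d i).2⟩
  have hj : (d j : F) = -d i := by simp [j]
  have : CharP F 3 := charP_of_injective_algebraMap (algebraMap (ZMod 3) F).injective 3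
  have hij : i ≠ j := by
    intro h
    rw [← h] at hj
    exact (d i).2.1 ((Ring.eq_self_iff_eq_zero_of_char_ne_two
      (by rw [ringChar.eq F 3]; decide)).1 hj.symm)
  have hmin := isMinDistance_dualCode_traceCode_two (K := ZMod 3) (fun i => (d i : F))
    (fun i => (d i).2.1) hij hj
  refine ⟨hmin, isOptimalCode_dualCode_traceCode _ hmin ?_⟩
  rw [Nat.card_zmod]
  omega
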